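/- Fix an integer $M$. For each $N\ge 1$ let $\xi_1,\dots,\xi_N$ be i.i.d. random vectors $\xi_i=(\xi_i^1,\dots,\xi_i^M)\in\{-1,+1\}^M$ with independent coordinates and $\mathbb E[\xi_i^\nu]=0$, and write $\mathbb P_\xi$ for their law. For $\sigma\in\{-1,+1\}^N$ let $m_N(\sigma)\in\mathbb R^M$ be the overlap vector with coordinates $m_N^\nu(\sigma)=\frac1N\sum_{i=1}^N\sigma_i\xi_i^\nu$, and let \[ \mu_N(\sigma)=\frac1{Z_N}\exp\Big(\frac N2\|m_N(\sigma)\|^2\Big),\qquad Z_N=\sum_{\sigma'\in\{-1,+1\}^N}\exp\Big(\frac N2\|m_N(\sigma')\|^2\Big), \] be the Hopfield Gibbs measure at the critical inverse temperature $\beta=1$, where $\|\cdot\|$ is the Euclidean norm. For $k\le N$ let $\mu_N^{(k)}$ be the marginal of $\mu_N$ on $(\sigma_1,\dots,\sigma_k)$, let $\pi$ be the Rademacher law on $\{-1,+1\}$, $\pi(\pm1)=\frac12$, and let $d_{\mathrm{TV}}(p,q)=\frac12\sum_a|p(a)-q(a)|$ be the total variation distance. Let $k=k(N)\le N$ satisfy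 $k(N)\to\infty$ and $k(N)/\sqrt N\to0$ as $N\to\infty$. Then \[ d_{\mathrm{TV}}\big(\mu_N^{(k)},\pi^{\otimes k}\big)\longrightarrow 0\qquad\text{in }\mathbb P_\xi\text{-probability as }N\to\infty, \] that is, $\mathbb P_\xi\big(d_{\mathrm{TV}}(\mu_N^{(k)},\pi^{\otimes k})\ge\varepsilon\big)\to0$ for every $\varepsilon>0$. -/

import Mathlib

open MeasureTheory ProbabilityTheory Filter Topology

noncomputable section

namespace Hopfield

/-- A single spin, an element of `{-1, +1}`. -/
abbrev Spin : Type := ℤˣ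

/-- The spin as a real number `±1`. -/
def Spin.val (s : Spin) : ℝ := ((s : ℤ) : ℝ)

/-- The overlap vector `m_N(σ)`, with coordinates `m_N^ν(σ) = (1/N) ∑ i, σ_i ξ_i^ν`, for a fixed
realization `x` of the patterns. It lives in `ℝ^M` with the Euclidean norm. -/
def overlap {N M : ℕ} (x : Fin N → Fin M → ℝ) (σ : Fin N → Spin) : EuclideanSpace ℝ (Fin M) :=
  WithLp.toLp 2 (fun ν => (1 / (N : ℝ)) * ∑ i, Spin.val (σ i) * x i ν)

/-- The Boltzmann weight `exp ((β N / 2) ‖m_N(σ)‖²)`. -/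
def weight {N M : ℕ} (β : ℝ) (x : Fin N → Fin M → ℝ) (σ : Fin N → Spin) : ℝ :=
  Real.exp (β * (N : ℝ) / 2 * ‖overlap x σ‖ ^ 2)

/-- The partition function `Z_N`. -/
def partition {N M : ℕ} (β : ℝ) (x : Fin N → Fin M → ℝ) : ℝ :=
  ∑ σ : Fin N → Spin, weight β x σ

/-- The probability mass function of the Hopfield Gibbs measure `μ_N` on `{-1, +1}^N` at inverse
temperature `β`, for a fixed realization `x` of the patterns. -/
def gibbs {N M : ℕ} (β : ℝ) (x : Fin N → Fin M → ℝ) (σ : Fin N → Spin) : ℝ :=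
  weight β x σ / partition β x

/-- The probability mass function of the marginal `μ_N^{(k)}` of `μ_N` on the first `k` spins. -/
def gibbsMarginal {N M k : ℕ} (hk : k ≤ N) (β : ℝ) (x : Fin N → Fin M → ℝ)
    (τ : Fin k → Spin) : ℝ :=
  ∑ σ : Fin N → Spin with (fun i : Fin k => σ (Fin.castLE hk i)) = τ, gibbs β x σ

/-- The probability mass function of the Rademacher law `π` on `{-1, +1}`. -/
def rademacher (_s : Spin) : ℝ := 1 / 2

/-- The probability mass function of the product law `π^{⊗k}` on `{-1, +1}^k`. -/
def rademacherProd (k : ℕ) (τ : Fin k → Spin) : ℝ := ∏ i, rademacher (τ i)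

/-- The total variation distance of two probability mass functions on a finite set,
`(1/2) ∑ a, |p a - q a|`. -/
def tvDist {α : Type*} [Fintype α] (p q : α → ℝ) : ℝ := (1 / 2) * ∑ a, |p a - q a|

/-- `ξ_1, …, ξ_N` are i.i.d. random vectors in `{-1, +1}^M` with independent, centred coordinates
(the condition `E[(ξ_i^ν)²] = 1` holds automatically). -/
structure IsPatternFamily {Ω : Type*} [MeasurableSpace Ω] (P : Measure Ω) {N M : ℕ}
    (ξ : Fin N → Ω → Fin M → ℝ) : Prop where
  measurable : ∀ i, Measurable (ξ i)
  values : ∀ i ω ν, ξ i ω ν = -1 ∨ ξ i ω ν = 1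
  indep : iIndepFun ξ P
  identDistrib : ∀ i j, IdentDistrib (ξ i) (ξ j) P P
  coordIndep : ∀ i, iIndepFun (fun (ν : Fin M) (ω : Ω) => ξ i ω ν) P
  centred : ∀ i ν, ∫ ω, ξ i ω ν ∂P = 0

end Hopfield

end

noncomputable section

namespace Hopfield

/-! The Hubbard–Stratonovich transform linearizes the quadratic energy with an auxiliary Gaussian
vector `w` in `ℝ^M`. Given `w`, the spins are independent with fields `⟨w, x_i⟩ / N^{1/4}`, so the
marginal is a mixture of product laws (`gibbsMarginal_mul_integral`). Such a product lies within
`√(∑ h_i²) ≤ √(M k / √N) ‖w‖` of uniform in total variation. Since `k / √N → 0`, it remains to bound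
the mean of `‖w‖` uniformly in `N`.

At `β = 1` the quadratic part of `∑ log cosh h_i` cancels the Gaussian exponent, up to an error
`(K/2) ‖w‖²` when the empirical correlation matrix of the patterns is within `K / √N` of the
identity. The scale `N^{1/4}` makes the quartic term of order one. Hence, up to the factor `2^N`,
the density of `w` has an integrable lower bound (`le_hsDensity`) and a Gaussian upper bound
(`hsDensity_le`), both independent of `N`. The correlation condition fails with probability at most
`M² / K²`, by Markov's inequality applied to the squared Frobenius norm. -/

/-! ### Quartic bounds on the hyperbolic cosine -/

lemma exp_quartic_le_cosh (x : ℝ) : Real.exp (x ^ 2 / 2 - x ^ 4 / 4) ≤ Real.cosh x := by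
  have hu : 0 ≤ x ^ 2 / 2 := by positivity
  have h1 : 1 + x ^ 2 / 2 ≤ Real.cosh x := by
    have h2 : Real.cosh |x| = 1 + 2 * Real.sinh (|x| / 2) ^ 2 := by
      have := Real.cosh_two_mul (|x| / 2)
      rw [show 2 * (|x| / 2) = |x| by ring, Real.cosh_sq] at this
      rw [this]; ring
    have h3 : |x| / 2 ≤ Real.sinh (|x| / 2) := Real.self_le_sinh_iff.2 (by positivity)
    have h4 : (|x| / 2) ^ 2 ≤ Real.sinh (|x| / 2) ^ 2 := pow_le_pow_left₀ (by positivity) h3 2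
    rw [div_pow, sq_abs] at h4
    rw [← Real.cosh_abs, h2]
    linarith
  refine le_trans ?_ h1
  have hpos : 0 < 1 + x ^ 2 / 2 := by positivity
  rw [← Real.le_log_iff_exp_le hpos]
  -- With `u = x²/2`: `log (1 + u) ≥ u / (1 + u) ≥ u - u²`, the last gap being `u³ / (1 + u)`.
  refine le_trans ?_ (Real.one_sub_inv_le_log_of_pos hpos)
  have : 1 - (1 + x ^ 2 / 2)⁻¹ - (x ^ 2 / 2 - x ^ 4 / 4)
      = (x ^ 2 / 2) ^ 3 / (1 + x ^ 2 / 2) := by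
    field_simp
    ring
  have h3 : 0 ≤ (x ^ 2 / 2) ^ 3 / (1 + x ^ 2 / 2) := by positivity
  linarith

/-- The gain over `exp (x²/2)` is quartic near zero but can only be quadratic at infinity, whence
the denominator. For small `x`, the duplication formula gives `cosh x ≤ 2 e^v - 1 = e^{2v} (1 - (1 -
e^{-v})²)` with `v = x²/4`; for large `x`, `cosh x ≤ e^{|x|}` suffices. -/
lemma cosh_le_exp_sub_quartic (x : ℝ) :
    Real.cosh x ≤ Real.exp (x ^ 2 / 2 - x ^ 4 / (400 * (1 + x ^ 2))) := by
  have hx2 : 0 ≤ x ^ 2 := sq_nonneg x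
  by_cases hx : x ^ 2 ≤ 16
  · set v := x ^ 2 / 4 with hv
    have hv0 : 0 ≤ v := by positivity
    have h1 : Real.cosh (x / 2) ^ 2 ≤ Real.exp v := by
      have := Real.cosh_le_exp_half_sq (x / 2)
      calc Real.cosh (x / 2) ^ 2 ≤ Real.exp ((x / 2) ^ 2 / 2) ^ 2 := by
            gcongr
        _ = Real.exp v := by rw [← Real.exp_nat_mul]; congr 1; rw [hv]; push_cast; ring
    have h2 : Real.cosh x = 2 * Real.cosh (x / 2) ^ 2 - 1 := by
      have := Real.cosh_two_mul (x / 2)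
      rw [show 2 * (x / 2) = x by ring, Real.sinh_sq] at this
      rw [this]; ring
    have h3 : v / (1 + v) ≤ 1 - Real.exp (-v) := by
      have : Real.exp (-v) ≤ (1 + v)⁻¹ := by
        rw [Real.exp_neg]
        exact inv_anti₀ (by positivity) (by linarith [Real.add_one_le_exp v])
      have h4 : v / (1 + v) = 1 - (1 + v)⁻¹ := by field_simp; ring
      linarith
    have h4 : x ^ 4 / (400 * (1 + x ^ 2)) ≤ (1 - Real.exp (-v)) ^ 2 := by
      refine le_trans ?_ (pow_le_pow_left₀ (by positivity) h3 2)
      rw [div_pow, div_le_div_iff₀ (by positivity) (by positivity)]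
      -- Here `v ≤ 4`, and `400 = 16 · 25`.
      have h5 : (1 + v) ^ 2 ≤ 25 := by nlinarith
      have h6 : x ^ 4 = 16 * v ^ 2 := by rw [hv]; ring
      rw [h6]
      have : 0 ≤ v ^ 2 * x ^ 2 := by positivity
      have := mul_le_mul_of_nonneg_left h5 (sq_nonneg v)
      nlinarith
    calc Real.cosh x ≤ 2 * Real.exp v - 1 := by rw [h2]; linarith
      _ = Real.exp (2 * v) * (1 - (1 - Real.exp (-v)) ^ 2) := by
          have : Real.exp (2 * v) = Real.exp v ^ 2 := by
            rw [← Real.exp_nat_mul]; norm_num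
          rw [this, Real.exp_neg]
          have := Real.exp_pos v
          field_simp
          ring
      _ ≤ Real.exp (2 * v) * Real.exp (-(1 - Real.exp (-v)) ^ 2) := by
          gcongr
          linarith [Real.add_one_le_exp (-(1 - Real.exp (-v)) ^ 2)]
      _ = Real.exp (2 * v - (1 - Real.exp (-v)) ^ 2) := by
          rw [← Real.exp_add]; rfl
      _ ≤ _ := by
          apply Real.exp_le_exp.2
          have : 2 * v = x ^ 2 / 2 := by rw [hv]; ring
          linarith
  · push Not at hx
    have hax : 4 ≤ |x| := by
      by_contra h
      push Not at h
      have := sq_lt_sq' (by linarith [abs_nonneg x]) h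
      rw [sq_abs] at this
      linarith
    have h1 : Real.cosh x ≤ Real.exp |x| := by
      rw [← Real.cosh_abs, Real.cosh_eq]
      have : Real.exp (-|x|) ≤ Real.exp |x| :=
        Real.exp_le_exp.2 (by linarith)
      linarith
    refine h1.trans (Real.exp_le_exp.2 ?_)
    have h2 : x ^ 4 / (400 * (1 + x ^ 2)) ≤ x ^ 2 / 4 := by
      rw [div_le_div_iff₀ (by positivity) (by positivity)]
      nlinarith [mul_nonneg hx2 hx2]
    have h3 : |x| ≤ x ^ 2 / 4 := by
      rw [← sq_abs]; nlinarith
    linarith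

/-! ### Products of tilted spins -/

/-- The spin law with external field `h`. -/
def tilt (h : ℝ) (s : Spin) : ℝ := Real.exp (s.val * h) / (2 * Real.cosh h)

lemma sum_spin (f : Spin → ℝ) : ∑ s, f s = f 1 + f (-1) := by
  have : (Finset.univ : Finset Spin) = {1, -1} := by decide
  rw [this, Finset.sum_pair (by decide)]

@[simp] lemma Spin.val_one : Spin.val 1 = 1 := by simp [Spin.val]
@[simp] lemma Spin.val_neg_one : Spin.val (-1) = -1 := by simp [Spin.val]

lemma sum_exp_spin (h : ℝ) : ∑ s : Spin, Real.exp (s.val * h) = 2 * Real.cosh h := by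
  rw [sum_spin, Real.cosh_eq]; simp; ring

lemma tilt_nonneg (h : ℝ) (s : Spin) : 0 ≤ tilt h s := by
  unfold tilt; have := Real.cosh_pos h; positivity

lemma sum_tilt (h : ℝ) : ∑ s, tilt h s = 1 := by
  unfold tilt
  rw [← Finset.sum_div, sum_exp_spin, div_self]
  have := Real.cosh_pos h; positivity

/-- The left side is one plus the chi-square divergence from the Rademacher law, a quantity that
multiplies over independent spins. It equals `2 - 1 / cosh² h`; then use `cosh² h ≤ e^{h²}` and `2 -
1/y ≤ y`. -/
lemma two_mul_sum_tilt_sq_le (h : ℝ) : 2 * ∑ s, tilt h s ^ 2 ≤ Real.exp (h ^ 2) := by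
  have hc := Real.cosh_pos h
  have h1 : 2 * ∑ s, tilt h s ^ 2 = 2 - (Real.cosh h ^ 2)⁻¹ := by
    rw [sum_spin]
    simp only [tilt, Spin.val_one, Spin.val_neg_one, one_mul, neg_one_mul]
    have e1 : Real.exp h = Real.cosh h + Real.sinh h := (Real.cosh_add_sinh h).symm
    have e2 : Real.exp (-h) = Real.cosh h - Real.sinh h := (Real.cosh_sub_sinh h).symm
    rw [e1, e2]
    field_simp
    have := Real.sinh_sq h
    linear_combination 2 * this
  have h2 : Real.cosh h ^ 2 ≤ Real.exp (h ^ 2) := by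
    calc Real.cosh h ^ 2 ≤ Real.exp (h ^ 2 / 2) ^ 2 := by
          gcongr
          exact Real.cosh_le_exp_half_sq h
      _ = _ := by rw [← Real.exp_nat_mul]; congr 1; push_cast; ring
  have h3 : (Real.exp (h ^ 2))⁻¹ ≤ (Real.cosh h ^ 2)⁻¹ := inv_anti₀ (by positivity) h2
  have h4 : 2 - (Real.exp (h ^ 2))⁻¹ ≤ Real.exp (h ^ 2) := by
    have hp := Real.exp_pos (h ^ 2)
    have : Real.exp (h ^ 2) - (2 - (Real.exp (h ^ 2))⁻¹)
      = (Real.exp (h ^ 2) - 1) ^ 2 / Real.exp (h ^ 2) := by field_simp; ring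
    have : 0 ≤ (Real.exp (h ^ 2) - 1) ^ 2 / Real.exp (h ^ 2) := by positivity
    linarith
  rw [h1]; linarith

lemma sum_prod_spin {k : ℕ} (f : Fin k → Spin → ℝ) :
    ∑ τ : Fin k → Spin, ∏ i, f i (τ i) = ∏ i, ∑ s, f i s := by
  rw [Finset.prod_univ_sum, Fintype.piFinset_univ]

lemma rademacherProd_eq (k : ℕ) (τ : Fin k → Spin) : rademacherProd k τ = (1 / 2) ^ k := by
  simp [rademacherProd, rademacher]

lemma card_spin_fun (k : ℕ) : (Finset.univ : Finset (Fin k → Spin)).card = 2 ^ k := by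
  have : Fintype.card Spin = 2 := by decide
  rw [Finset.card_univ, Fintype.card_fun, this, Fintype.card_fin]

/-- Total variation bound for a product of tilted spins against the uniform law. -/
lemma sum_abs_prod_tilt_sub_le {k : ℕ} (h : Fin k → ℝ) :
    ∑ τ : Fin k → Spin, |∏ i, tilt (h i) (τ i) - rademacherProd k τ|
      ≤ 2 * Real.sqrt (∑ i, h i ^ 2) := by
  set u := ∑ i, h i ^ 2 with hu
  have hu0 : 0 ≤ u := Finset.sum_nonneg fun i _ => sq_nonneg _
  simp only [rademacherProd_eq]
  set p : (Fin k → Spin) → ℝ := fun τ => ∏ i, tilt (h i) (τ i) with hp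
  have hp0 : ∀ τ, 0 ≤ p τ := fun τ => Finset.prod_nonneg fun i _ => tilt_nonneg _ _
  have hp1 : ∑ τ, p τ = 1 := by
    rw [hp, sum_prod_spin fun i s => tilt (h i) s]
    exact Finset.prod_eq_one fun i _ => sum_tilt _
  have hq1 : ∑ _τ : Fin k → Spin, ((1 / 2 : ℝ)) ^ k = 1 := by
    rw [Finset.sum_const, card_spin_fun, nsmul_eq_mul]
    push_cast
    rw [← mul_pow]; norm_num
  change ∑ τ, |p τ - (1 / 2) ^ k| ≤ _
  -- For `u ≤ 1`, Cauchy–Schwarz bounds the squared `ℓ¹` distance by the chi-square divergence, at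
  -- most `e^u - 1 ≤ 2u`. For `u > 1` the trivial bound `2` is enough.
  by_cases h1 : u ≤ 1
  · have hcs : (∑ τ, |p τ - (1 / 2) ^ k|) ^ 2 ≤ 2 ^ k * ∑ τ, (p τ - (1 / 2) ^ k) ^ 2 := by
      have := sq_sum_le_card_mul_sum_sq (s := (Finset.univ : Finset (Fin k → Spin)))
        (f := fun τ => |p τ - (1 / 2) ^ k|)
      rw [card_spin_fun] at this
      simpa only [sq_abs, Nat.cast_pow, Nat.cast_ofNat] using this
    have hsq : 2 ^ k * ∑ τ, (p τ - (1 / 2) ^ k) ^ 2 = 2 ^ k * ∑ τ, p τ ^ 2 - 1 := by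
      have e : ∀ τ, (p τ - (1 / 2) ^ k) ^ 2
          = p τ ^ 2 - 2 * (1 / 2) ^ k * p τ + (1 / 2) ^ k * (1 / 2) ^ k := fun τ => by ring
      simp only [e]
      rw [Finset.sum_add_distrib, Finset.sum_sub_distrib, ← Finset.mul_sum, ← Finset.mul_sum,
        hp1, hq1]
      have : (2 : ℝ) ^ k * (1 / 2) ^ k = 1 := by rw [← mul_pow]; norm_num
      linear_combination (-1) * this
    have hpr : 2 ^ k * ∑ τ, p τ ^ 2 ≤ Real.exp u := by
      have e : ∀ τ, p τ ^ 2 = ∏ i, tilt (h i) (τ i) ^ 2 := fun τ => by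
        rw [hp, Finset.prod_pow]
      simp only [e]
      rw [sum_prod_spin fun i s => tilt (h i) s ^ 2, hu, Real.exp_sum]
      have : (2 : ℝ) ^ k = ∏ _i : Fin k, 2 := by simp
      rw [this, ← Finset.prod_mul_distrib]
      refine Finset.prod_le_prod (fun i _ => ?_) fun i _ => two_mul_sum_tilt_sq_le _
      exact mul_nonneg zero_le_two (Finset.sum_nonneg fun s _ => sq_nonneg _)
    have hexp : Real.exp u - 1 ≤ 2 * u := by
      have := Real.abs_exp_sub_one_le (x := u) (by rwa [abs_of_nonneg hu0])
      rw [abs_of_nonneg hu0] at this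
      exact (le_abs_self _).trans this
    refine abs_le_of_sq_le_sq' ?_ (by positivity) |>.2
    rw [mul_pow, Real.sq_sqrt hu0]
    linarith
  · push Not at h1
    have hT : ∑ τ, |p τ - (1 / 2) ^ k| ≤ 2 := by
      calc ∑ τ, |p τ - (1 / 2) ^ k| ≤ ∑ τ, (p τ + (1 / 2) ^ k) := by
            refine Finset.sum_le_sum fun τ _ => ?_
            refine (abs_sub _ _).trans ?_
            rw [abs_of_nonneg (hp0 τ), abs_of_nonneg (by positivity)]
        _ = 2 := by rw [Finset.sum_add_distrib, hp1, hq1]; norm_num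
    have : 1 ≤ Real.sqrt u := Real.one_le_sqrt.2 h1.le
    linarith

/-- The sum over configurations with prescribed first `k` spins of a product factorizes. -/
lemma sum_filter_prod_castLE {N k : ℕ} (hk : k ≤ N) (f : Fin N → Spin → ℝ) (τ : Fin k → Spin)
    (hf : ∀ i, ∑ s, f i s ≠ 0) :
    ∑ σ : Fin N → Spin with (fun i : Fin k => σ (Fin.castLE hk i)) = τ, ∏ i, f i (σ i)
      = (∏ i, ∑ s, f i s) *
        ∏ i : Fin k, f (Fin.castLE hk i) (τ i) / ∑ s, f (Fin.castLE hk i) s := by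
  obtain ⟨r, rfl⟩ := Nat.exists_eq_add_of_le hk
  have hc : ∀ i : Fin k, Fin.castLE hk i = Fin.castAdd r i := fun i => rfl
  simp only [hc]
  -- The constraint on the first `k` spins becomes an indicator in each of their factors, leaving an
  -- unconstrained sum of a product.
  have key : ∀ σ : Fin (k + r) → Spin,
      (if (fun i : Fin k => σ (Fin.castAdd r i)) = τ then ∏ i, f i (σ i) else 0)
      = ∏ i, Fin.addCases (motive := fun _ => Spin → ℝ)
          (fun j s => if s = τ j then f (Fin.castAdd r j) s else 0)
          (fun j s => f (Fin.natAdd k j) s) i (σ i) := by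
    intro σ
    rw [Fin.prod_univ_add, Fin.prod_univ_add]
    simp only [Fin.addCases_left, Fin.addCases_right]
    split_ifs with h
    · congr 1
      refine Finset.prod_congr rfl fun j _ => ?_
      rw [if_pos (congrFun h j)]
    · obtain ⟨j, hj⟩ := Function.ne_iff.1 h
      rw [Finset.prod_eq_zero (Finset.mem_univ j), zero_mul]
      exact if_neg hj
  rw [Finset.sum_filter]
  simp only [key]
  rw [sum_prod_spin, Fin.prod_univ_add, Fin.prod_univ_add]
  simp only [Fin.addCases_left, Fin.addCases_right]
  rw [Finset.prod_div_distrib]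
  simp only [Finset.sum_ite_eq', Finset.mem_univ, if_true]
  have : ∏ i, ∑ s, f (Fin.castAdd r i) s ≠ 0 := Finset.prod_ne_zero_iff.2 fun i _ => hf _
  field_simp

/-! ### Hubbard–Stratonovich transform -/

variable {N M : ℕ}

/-- The scaled local field at site `i`, `⟨w, x_i⟩ / N^{1/4}`. -/
def field (x : Fin N → Fin M → ℝ) (w : EuclideanSpace ℝ (Fin M)) (i : Fin N) : ℝ :=
  (∑ ν, w ν * x i ν) / Real.sqrt (Real.sqrt N)

/-- The unnormalized Hubbard–Stratonovich density. -/
def hsDensity (x : Fin N → Fin M → ℝ) (w : EuclideanSpace ℝ (Fin M)) : ℝ :=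
  Real.exp (-(Real.sqrt N / 2) * ‖w‖ ^ 2) * ∏ i, (2 * Real.cosh (field x w i))

/-- The joint density of the Hubbard–Stratonovich variable and the spins. -/
def hsJoint (x : Fin N → Fin M → ℝ) (σ : Fin N → Spin) (w : EuclideanSpace ℝ (Fin M)) : ℝ :=
  Real.exp (-(Real.sqrt N / 2) * ‖w‖ ^ 2) * ∏ i, Real.exp ((σ i).val * field x w i)

/-- The Gaussian normalization. -/
def gaussConst (N M : ℕ) : ℝ :=
  ∫ w : EuclideanSpace ℝ (Fin M), Real.exp (-(Real.sqrt N / 2) * ‖w‖ ^ 2)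

lemma integrable_gauss {b : ℝ} (hb : 0 < b) :
    Integrable (fun w : EuclideanSpace ℝ (Fin M) => Real.exp (-b * ‖w‖ ^ 2)) := by
  have := GaussianFourier.integrable_cexp_neg_mul_sq_norm_add (V := EuclideanSpace ℝ (Fin M))
    (b := (b : ℂ)) (by simpa using hb) 0 0
  have h2 := this.re
  refine h2.congr (ae_of_all _ fun w => ?_)
  simp only [zero_mul, add_zero, RCLike.re_to_complex]
  rw [show -(b : ℂ) * (‖w‖ : ℂ) ^ 2 = ((-b * ‖w‖ ^ 2 : ℝ) : ℂ) by push_cast; ring,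
    Complex.exp_ofReal_re]

lemma integral_gauss_pos {b : ℝ} (hb : 0 < b) :
    0 < ∫ w : EuclideanSpace ℝ (Fin M), Real.exp (-b * ‖w‖ ^ 2) :=
  integral_exp_pos (integrable_gauss hb)

lemma gaussConst_pos (hN : 0 < N) : 0 < gaussConst N M :=
  integral_gauss_pos (by positivity)

lemma overlap_apply (x : Fin N → Fin M → ℝ) (σ : Fin N → Spin) (ν : Fin M) :
    overlap x σ ν = (1 / (N : ℝ)) * ∑ i, Spin.val (σ i) * x i ν := rfl

/-- Completing the square around `N^{1/4} m_N(σ)` leaves exactly the Boltzmann weight at `β = 1`. By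
translation invariance, integrating out `w` then recovers the Gibbs weight with a constant
independent of `σ`. -/
lemma hsJoint_eq (hN : 0 < N) (x : Fin N → Fin M → ℝ) (σ : Fin N → Spin)
    (w : EuclideanSpace ℝ (Fin M)) :
    hsJoint x σ w = weight 1 x σ *
      Real.exp (-(Real.sqrt N / 2) * ‖w - Real.sqrt (Real.sqrt N) • overlap x σ‖ ^ 2) := by
  have hs : 0 < Real.sqrt N := Real.sqrt_pos.2 (by exact_mod_cast hN)
  have hs2 : Real.sqrt N ^ 2 = N := Real.sq_sqrt (by positivity)
  set s := Real.sqrt N with hsd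
  have ha : 0 < Real.sqrt s := Real.sqrt_pos.2 hs
  have ha2 : Real.sqrt s ^ 2 = s := Real.sq_sqrt hs.le
  set a := Real.sqrt s with had
  have hin : s * a * inner ℝ w (overlap x σ) = ∑ i, (σ i).val * field x w i := by
    simp only [field, ← hsd, ← had]
    rw [PiLp.inner_apply]
    simp only [overlap_apply, RCLike.inner_apply, conj_trivial]
    have e1 : ∀ i, (σ i).val * ((∑ ν, w ν * x i ν) / a)
        = ∑ ν, (1 / a) * (w ν * ((σ i).val * x i ν)) := fun i => by
      rw [mul_div_assoc', Finset.mul_sum, Finset.sum_div]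
      refine Finset.sum_congr rfl fun ν _ => ?_
      ring
    simp only [e1]
    rw [Finset.sum_comm, Finset.mul_sum]
    refine Finset.sum_congr rfl fun ν _ => ?_
    rw [← Finset.mul_sum, ← Finset.mul_sum]
    have : s * a * (1 / (N : ℝ)) = 1 / a := by
      rw [← hs2, ← ha2]; field_simp
    rw [← this]; ring
  rw [hsJoint, weight, ← Real.exp_sum, ← Real.exp_add, ← Real.exp_add, ← hin]
  congr 1
  rw [norm_sub_sq_real, norm_smul, real_inner_smul_right, mul_pow, Real.norm_eq_abs, sq_abs, ha2,
    ← hsd, ← hs2]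
  ring

lemma integrable_hsJoint (hN : 0 < N) (x : Fin N → Fin M → ℝ) (σ : Fin N → Spin) :
    Integrable (hsJoint x σ) := by
  have : hsJoint x σ = _ := funext (hsJoint_eq hN x σ)
  rw [this]
  have h := integrable_gauss (M := M) (b := Real.sqrt N / 2) (by positivity)
  exact (h.comp_sub_right (Real.sqrt (Real.sqrt N) • overlap x σ)).const_mul _

lemma integral_hsJoint (hN : 0 < N) (x : Fin N → Fin M → ℝ) (σ : Fin N → Spin) :
    ∫ w, hsJoint x σ w = weight 1 x σ * gaussConst N M := by
  simp only [hsJoint_eq hN x σ]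
  rw [integral_const_mul, gaussConst]
  congr 1
  exact integral_sub_right_eq_self
    (fun w : EuclideanSpace ℝ (Fin M) => Real.exp (-(Real.sqrt N / 2) * ‖w‖ ^ 2)) _

lemma hsDensity_nonneg (x : Fin N → Fin M → ℝ) (w : EuclideanSpace ℝ (Fin M)) :
    0 ≤ hsDensity x w :=
  mul_nonneg (Real.exp_pos _).le (Finset.prod_nonneg fun _ _ =>
    mul_nonneg zero_le_two (Real.cosh_pos _).le)

lemma sum_hsJoint (x : Fin N → Fin M → ℝ) (w : EuclideanSpace ℝ (Fin M)) :
    ∑ σ, hsJoint x σ w = hsDensity x w := by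
  simp only [hsJoint, hsDensity]
  rw [← Finset.mul_sum, sum_prod_spin fun i s => Real.exp (s.val * field x w i)]
  simp only [sum_exp_spin]

lemma sum_filter_hsJoint {k : ℕ} (hk : k ≤ N) (x : Fin N → Fin M → ℝ)
    (w : EuclideanSpace ℝ (Fin M)) (τ : Fin k → Spin) :
    ∑ σ : Fin N → Spin with (fun i : Fin k => σ (Fin.castLE hk i)) = τ, hsJoint x σ w
      = hsDensity x w * ∏ i : Fin k, tilt (field x w (Fin.castLE hk i)) (τ i) := by
  simp only [hsJoint, hsDensity]
  rw [← Finset.mul_sum, sum_filter_prod_castLE hk fun i s => Real.exp (s.val * field x w i)]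
  · simp only [sum_exp_spin, tilt, mul_assoc]
  · intro i
    rw [sum_exp_spin]
    have := Real.cosh_pos (field x w i)
    positivity

lemma integrable_hsDensity (hN : 0 < N) (x : Fin N → Fin M → ℝ) : Integrable (hsDensity x) := by
  have : hsDensity x = fun w => ∑ σ, hsJoint x σ w := funext fun w => (sum_hsJoint x w).symm
  rw [this]
  exact integrable_finsetSum _ fun _ _ => integrable_hsJoint hN x _

lemma partition_pos (β : ℝ) (x : Fin N → Fin M → ℝ) : 0 < partition β x :=
  Finset.sum_pos (fun _ _ => Real.exp_pos _) Finset.univ_nonempty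

lemma integral_hsDensity (hN : 0 < N) (x : Fin N → Fin M → ℝ) :
    ∫ w, hsDensity x w = partition 1 x * gaussConst N M := by
  simp only [← sum_hsJoint]
  rw [integral_finsetSum _ fun σ _ => integrable_hsJoint hN x σ]
  simp only [integral_hsJoint hN x]
  rw [← Finset.sum_mul, partition]

lemma integral_hsDensity_pos (hN : 0 < N) (x : Fin N → Fin M → ℝ) :
    0 < ∫ w, hsDensity x w := by
  rw [integral_hsDensity hN]
  exact mul_pos (partition_pos _ _) (gaussConst_pos hN)

lemma integrable_hsDensity_mul_prod {k : ℕ} (hN : 0 < N) (hk : k ≤ N) (x : Fin N → Fin M → ℝ)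
    (τ : Fin k → Spin) :
    Integrable fun w => hsDensity x w * ∏ i : Fin k, tilt (field x w (Fin.castLE hk i)) (τ i) := by
  simp only [← sum_filter_hsJoint hk]
  exact integrable_finsetSum _ fun σ _ => integrable_hsJoint hN x σ

/-- The marginal is a mixture of products of tilted spins. -/
lemma gibbsMarginal_mul_integral {k : ℕ} (hN : 0 < N) (hk : k ≤ N) (x : Fin N → Fin M → ℝ)
    (τ : Fin k → Spin) :
    gibbsMarginal hk 1 x τ * ∫ w, hsDensity x w
      = ∫ w, hsDensity x w * ∏ i : Fin k, tilt (field x w (Fin.castLE hk i)) (τ i) := by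
  simp only [← sum_filter_hsJoint hk]
  rw [integral_finsetSum _ fun σ _ => integrable_hsJoint hN x σ, integral_hsDensity hN]
  simp only [integral_hsJoint hN x, gibbsMarginal, gibbs]
  rw [← Finset.sum_div, ← Finset.sum_mul]
  have := (partition_pos 1 x).ne'
  field_simp

/-! ### Total variation through the mixing variable -/

lemma sq_sum_mul_le (x : Fin N → Fin M → ℝ) (hx : ∀ i ν, x i ν = -1 ∨ x i ν = 1)
    (w : EuclideanSpace ℝ (Fin M)) (i : Fin N) :
    (∑ ν, w ν * x i ν) ^ 2 ≤ M * ‖w‖ ^ 2 := by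
  have h := Finset.sum_mul_sq_le_sq_mul_sq Finset.univ (fun ν => w ν) (fun ν => x i ν)
  have h1 : ∀ ν, x i ν ^ 2 = 1 := fun ν => by rcases hx i ν with h | h <;> rw [h] <;> norm_num
  rw [EuclideanSpace.real_norm_sq_eq]
  simp only [h1, Finset.sum_const, Finset.card_univ, Fintype.card_fin, nsmul_eq_mul, mul_one] at h
  linarith

lemma field_sq (x : Fin N → Fin M → ℝ) (w : EuclideanSpace ℝ (Fin M)) (i : Fin N) :
    field x w i ^ 2 = (∑ ν, w ν * x i ν) ^ 2 / Real.sqrt N := by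
  rw [field, div_pow, Real.sq_sqrt (Real.sqrt_nonneg _)]

lemma field_sq_le (x : Fin N → Fin M → ℝ) (hx : ∀ i ν, x i ν = -1 ∨ x i ν = 1)
    (w : EuclideanSpace ℝ (Fin M)) (i : Fin N) :
    field x w i ^ 2 ≤ M * ‖w‖ ^ 2 / Real.sqrt N := by
  rw [field_sq]
  gcongr
  exact sq_sum_mul_le x hx w i

/-- The total variation distance is controlled by the first moment of the mixing variable. -/
lemma tvDist_mul_integral_le {k : ℕ} (hN : 0 < N) (hk : k ≤ N) (x : Fin N → Fin M → ℝ)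
    (hx : ∀ i ν, x i ν = -1 ∨ x i ν = 1)
    (hint : Integrable fun w => hsDensity x w * ‖w‖) :
    tvDist (gibbsMarginal hk 1 x) (rademacherProd k) * ∫ w, hsDensity x w
      ≤ Real.sqrt (M * (k / Real.sqrt N)) * ∫ w, hsDensity x w * ‖w‖ := by
  have hZ := integral_hsDensity_pos hN x
  have hint' : ∀ τ : Fin k → Spin, Integrable fun w => hsDensity x w *
      (∏ i : Fin k, tilt (field x w (Fin.castLE hk i)) (τ i) - rademacherProd k τ) := fun τ => by
    simp only [mul_sub]
    exact (integrable_hsDensity_mul_prod hN hk x τ).sub ((integrable_hsDensity hN x).mul_const _)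
  have h1 : ∀ τ : Fin k → Spin,
      |gibbsMarginal hk 1 x τ - rademacherProd k τ| * ∫ w, hsDensity x w
      ≤ ∫ w, hsDensity x w *
        |∏ i : Fin k, tilt (field x w (Fin.castLE hk i)) (τ i) - rademacherProd k τ| := fun τ => by
    have h0 : |gibbsMarginal hk 1 x τ - rademacherProd k τ| * ∫ w, hsDensity x w
        = |(gibbsMarginal hk 1 x τ - rademacherProd k τ) * ∫ w, hsDensity x w| := by
      rw [abs_mul, abs_of_pos hZ]
    rw [h0, sub_mul, gibbsMarginal_mul_integral hN,
      ← integral_const_mul, ← integral_sub (integrable_hsDensity_mul_prod hN hk x τ)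
        ((integrable_hsDensity hN x).const_mul _)]
    refine (abs_integral_le_integral_abs).trans (le_of_eq ?_)
    congr 1
    ext w
    rw [mul_comm (rademacherProd k τ), ← mul_sub, abs_mul, abs_of_nonneg (hsDensity_nonneg x w)]
  have hint'' : ∀ τ : Fin k → Spin, Integrable fun w => hsDensity x w *
      |∏ i : Fin k, tilt (field x w (Fin.castLE hk i)) (τ i) - rademacherProd k τ| := fun τ => by
    refine (hint' τ).abs.congr (ae_of_all _ fun w => ?_)
    simp only [abs_mul, abs_of_nonneg (hsDensity_nonneg x w)]
  -- For fixed `w` the product bound applies, with `∑ h_i² ≤ k · M ‖w‖² / √N`. The factor `2` is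
  -- absorbed by the `1/2` in `tvDist`.
  have h2 : ∀ w, ∑ τ : Fin k → Spin, hsDensity x w *
      |∏ i : Fin k, tilt (field x w (Fin.castLE hk i)) (τ i) - rademacherProd k τ|
      ≤ 2 * Real.sqrt (M * (k / Real.sqrt N)) * (hsDensity x w * ‖w‖) := fun w => by
    rw [← Finset.mul_sum]
    have h3 := sum_abs_prod_tilt_sub_le fun i : Fin k => field x w (Fin.castLE hk i)
    have h4 : Real.sqrt (∑ i : Fin k, field x w (Fin.castLE hk i) ^ 2)
        ≤ Real.sqrt (M * (k / Real.sqrt N)) * ‖w‖ := by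
      have h0 : Real.sqrt (M * (k / Real.sqrt N)) * ‖w‖
          = Real.sqrt (M * (k / Real.sqrt N) * ‖w‖ ^ 2) := by
        rw [Real.sqrt_mul' _ (sq_nonneg ‖w‖), Real.sqrt_sq (norm_nonneg w)]
      rw [h0]
      refine Real.sqrt_le_sqrt ?_
      refine (Finset.sum_le_sum fun i _ => field_sq_le x hx w _).trans (le_of_eq ?_)
      rw [Finset.sum_const, Finset.card_univ, Fintype.card_fin, nsmul_eq_mul]
      ring
    calc _ ≤ hsDensity x w * (2 * (Real.sqrt (M * (k / Real.sqrt N)) * ‖w‖)) :=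
          mul_le_mul_of_nonneg_left (h3.trans (by linarith)) (hsDensity_nonneg x w)
      _ = _ := by ring
  have h5 := Finset.sum_le_sum fun τ (_ : τ ∈ Finset.univ) => h1 τ
  rw [← Finset.sum_mul, ← integral_finsetSum _ fun τ _ => hint'' τ] at h5
  have h6 := integral_mono (integrable_finsetSum _ fun τ _ => hint'' τ)
    (hint.const_mul (2 * Real.sqrt (M * (k / Real.sqrt N)))) h2
  rw [integral_const_mul] at h6
  rw [tvDist]
  linarith

/-! ### Density bounds for nearly orthogonal patterns -/

/-- The entries of `N (C - 1)` with `C` the empirical correlation matrix of the patterns. -/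
def crossSum (x : Fin N → Fin M → ℝ) (μ ν : Fin M) : ℝ :=
  ∑ i, x i μ * x i ν - if μ = ν then (N : ℝ) else 0

/-- The squared Frobenius norm of `N (C - 1)`. -/
def crossSq (x : Fin N → Fin M → ℝ) : ℝ := ∑ μ, ∑ ν, crossSum x μ ν ^ 2

lemma sum_sq_sub_eq (x : Fin N → Fin M → ℝ) (w : EuclideanSpace ℝ (Fin M)) :
    ∑ i, (∑ ν, w ν * x i ν) ^ 2 - N * ‖w‖ ^ 2
      = ∑ p : Fin M × Fin M, (w p.1 * w p.2) * crossSum x p.1 p.2 := by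
  rw [Fintype.sum_prod_type]
  simp only [crossSum, mul_sub, Finset.sum_sub_distrib]
  congr 1
  · have e : ∀ i, (∑ ν, w ν * x i ν) ^ 2 = ∑ μ, ∑ ν, w μ * w ν * (x i μ * x i ν) := fun i => by
      rw [sq, Finset.sum_mul_sum]
      exact Finset.sum_congr rfl fun μ _ => Finset.sum_congr rfl fun ν _ => by ring
    simp only [e, Finset.mul_sum]
    rw [Finset.sum_comm]
    refine Finset.sum_congr rfl fun μ _ => ?_
    rw [Finset.sum_comm]
  · simp only [mul_ite, mul_zero, Finset.sum_ite_eq, Finset.mem_univ, if_true]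
    rw [EuclideanSpace.real_norm_sq_eq, Finset.mul_sum]
    refine Finset.sum_congr rfl fun μ _ => ?_
    ring

/-- Cauchy–Schwarz over pairs of indices: a quadratic form is controlled by the Frobenius norm of
its matrix. -/
lemma abs_sum_sq_sub_le (x : Fin N → Fin M → ℝ) {K : ℝ} (hK : 0 ≤ K)
    (hV : crossSq x ≤ K ^ 2 * N) (w : EuclideanSpace ℝ (Fin M)) :
    |∑ i, (∑ ν, w ν * x i ν) ^ 2 - N * ‖w‖ ^ 2| ≤ K * Real.sqrt N * ‖w‖ ^ 2 := by
  rw [sum_sq_sub_eq]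
  refine abs_le_of_sq_le_sq ?_ (by positivity)
  have h := Finset.sum_mul_sq_le_sq_mul_sq Finset.univ
    (fun p : Fin M × Fin M => w p.1 * w p.2) (fun p => crossSum x p.1 p.2)
  have h1 : ∑ p : Fin M × Fin M, (w p.1 * w p.2) ^ 2 = (‖w‖ ^ 2) ^ 2 := by
    rw [Fintype.sum_prod_type, EuclideanSpace.real_norm_sq_eq, sq (∑ i, w i ^ 2),
      Finset.sum_mul_sum]
    simp only [mul_pow]
  have h2 : ∑ p : Fin M × Fin M, crossSum x p.1 p.2 ^ 2 = crossSq x := by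
    rw [Fintype.sum_prod_type]; rfl
  rw [h1, h2] at h
  refine h.trans ?_
  rw [mul_pow, mul_pow, Real.sq_sqrt (Nat.cast_nonneg N), mul_comm]
  gcongr

/-- This is the cancellation at criticality: half of `∑ h_i²` offsets the Gaussian exponent `(√N /
2) ‖w‖²` up to an error free of `N`. -/
lemma abs_sum_field_sq_sub_le (hN : 0 < N) (x : Fin N → Fin M → ℝ) {K : ℝ} (hK : 0 ≤ K)
    (hV : crossSq x ≤ K ^ 2 * N) (w : EuclideanSpace ℝ (Fin M)) :
    |∑ i, field x w i ^ 2 - Real.sqrt N * ‖w‖ ^ 2| ≤ K * ‖w‖ ^ 2 := by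
  have hs : 0 < Real.sqrt N := Real.sqrt_pos.2 (by exact_mod_cast hN)
  have hs2 : Real.sqrt N * Real.sqrt N = N := Real.mul_self_sqrt (by positivity)
  have h := abs_sum_sq_sub_le x hK hV w
  simp only [field_sq]
  rw [← Finset.sum_div]
  have : (∑ i, (∑ ν, w ν * x i ν) ^ 2) / Real.sqrt N - Real.sqrt N * ‖w‖ ^ 2
      = (∑ i, (∑ ν, w ν * x i ν) ^ 2 - N * ‖w‖ ^ 2) / Real.sqrt N := by
    rw [eq_div_iff hs.ne', sub_mul, div_mul_cancel₀ _ hs.ne']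
    linear_combination (-‖w‖ ^ 2) * hs2
  rw [this, abs_div, abs_of_pos hs, div_le_iff₀ hs]
  linarith

lemma le_hsDensity (hN : 0 < N) (x : Fin N → Fin M → ℝ) (hx : ∀ i ν, x i ν = -1 ∨ x i ν = 1)
    {K : ℝ} (hK : 0 ≤ K) (hV : crossSq x ≤ K ^ 2 * N) (w : EuclideanSpace ℝ (Fin M)) :
    2 ^ N * Real.exp (-(K / 2 * ‖w‖ ^ 2) - M ^ 2 * ‖w‖ ^ 4 / 4) ≤ hsDensity x w := by
  have hs : 0 < Real.sqrt N := Real.sqrt_pos.2 (by exact_mod_cast hN)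
  have hs2 : Real.sqrt N * Real.sqrt N = N := Real.mul_self_sqrt (by positivity)
  have h := (abs_le.1 (abs_sum_field_sq_sub_le hN x hK hV w)).1
  have h4 : ∑ i, field x w i ^ 4 ≤ M ^ 2 * ‖w‖ ^ 4 := by
    calc ∑ i, field x w i ^ 4 ≤ ∑ _i : Fin N, (M * ‖w‖ ^ 2 / Real.sqrt N) ^ 2 := by
          refine Finset.sum_le_sum fun i _ => ?_
          rw [show field x w i ^ 4 = (field x w i ^ 2) ^ 2 by ring]
          exact pow_le_pow_left₀ (sq_nonneg _) (field_sq_le x hx w i) 2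
      _ = M ^ 2 * ‖w‖ ^ 4 := by
          rw [Finset.sum_const, Finset.card_univ, Fintype.card_fin, nsmul_eq_mul, div_pow,
            mul_div_assoc', div_eq_iff (by positivity)]
          linear_combination (-(M * ‖w‖ ^ 2) ^ 2) * hs2
  have hprod : ∏ i, (2 * Real.exp (field x w i ^ 2 / 2 - field x w i ^ 4 / 4))
      ≤ ∏ i, (2 * Real.cosh (field x w i)) :=
    Finset.prod_le_prod (fun i _ => by positivity) fun i _ =>
      mul_le_mul_of_nonneg_left (exp_quartic_le_cosh _) zero_le_two
  rw [Finset.prod_mul_distrib, ← Real.exp_sum, Finset.prod_const, Finset.card_univ,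
    Fintype.card_fin, Finset.sum_sub_distrib, ← Finset.sum_div, ← Finset.sum_div] at hprod
  rw [hsDensity]
  refine le_trans ?_ (mul_le_mul_of_nonneg_left hprod (Real.exp_pos _).le)
  rw [mul_left_comm, ← Real.exp_add]
  gcongr
  linarith

/-- The additive constant in the exponent of the Gaussian upper bound on the density. -/
def upperConst (K : ℝ) (M : ℕ) : ℝ := 1600 * (1 + M) * (1 + K / 2) ^ 2

/-- The quartic gain is at least `r² / (1600 B)` with `r = ‖w‖²`. It must dominate `L r` up to a
constant, where `L = 1 + K/2`: the `K/2` pays for the correlation error and the `1` is the Gaussian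
decay that remains. -/
lemma hsDensity_le (x : Fin N → Fin M → ℝ) (hx : ∀ i ν, x i ν = -1 ∨ x i ν = 1)
    {K : ℝ} (hK : 0 ≤ K) (hV : crossSq x ≤ K ^ 2 * N)
    (hs : 1600 * (1 + M) * (1 + K / 2) ≤ Real.sqrt N) (w : EuclideanSpace ℝ (Fin M)) :
    hsDensity x w ≤ 2 ^ N * Real.exp (upperConst K M - ‖w‖ ^ 2) := by
  have hs0 : 0 < Real.sqrt N := lt_of_lt_of_le (by positivity) hs
  have hN : 0 < N := by
    have := Real.sqrt_pos.1 hs0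
    exact_mod_cast this
  have hM0 : (0 : ℝ) ≤ M := Nat.cast_nonneg M
  have hsK : 2 * K ≤ Real.sqrt N := by nlinarith [mul_nonneg hM0 hK]
  have hs2 : (N : ℝ) = Real.sqrt N * Real.sqrt N := (Real.mul_self_sqrt (by positivity)).symm
  have h := abs_le.1 (abs_sum_field_sq_sub_le hN x hK hV w)
  set s := Real.sqrt N with hsd
  set r := ‖w‖ ^ 2 with hr
  have hr0 : 0 ≤ r := by positivity
  set q := ∑ i, field x w i ^ 2 with hq
  set B := 1 + M * r / s with hB
  have hB1 : 0 < B := by positivity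
  -- Cauchy–Schwarz over the `N = s²` sites turns the known sum of squares into a lower bound on the
  -- quartic sum.
  have hcs : q ^ 2 ≤ s * s * ∑ i, field x w i ^ 4 := by
    have := sq_sum_le_card_mul_sum_sq (s := (Finset.univ : Finset (Fin N)))
      (f := fun i => field x w i ^ 2)
    rw [Finset.card_univ, Fintype.card_fin, hs2] at this
    simpa only [← pow_mul] using this
  have hquart : q ^ 2 / (s * s) / (400 * B)
      ≤ ∑ i, field x w i ^ 4 / (400 * (1 + field x w i ^ 2)) := by
    calc q ^ 2 / (s * s) / (400 * B) ≤ (∑ i, field x w i ^ 4) / (400 * B) := by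
          gcongr
          rw [div_le_iff₀ (by positivity)]
          linarith
      _ = ∑ i, field x w i ^ 4 / (400 * B) := Finset.sum_div _ _ _
      _ ≤ _ := by
          refine Finset.sum_le_sum fun i _ => ?_
          have : 1 + field x w i ^ 2 ≤ B := by
            have := field_sq_le x hx w i
            rw [← hsd] at this
            linarith
          gcongr
  have hprod : ∏ i, (2 * Real.cosh (field x w i)) ≤ ∏ i, (2 * Real.exp (field x w i ^ 2 / 2
      - field x w i ^ 4 / (400 * (1 + field x w i ^ 2)))) :=
    Finset.prod_le_prod (fun i _ => by have := Real.cosh_pos (field x w i); positivity) fun i _ =>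
      mul_le_mul_of_nonneg_left (cosh_le_exp_sub_quartic _) zero_le_two
  rw [Finset.prod_mul_distrib (g := fun i => Real.exp (field x w i ^ 2 / 2
      - field x w i ^ 4 / (400 * (1 + field x w i ^ 2)))), ← Real.exp_sum, Finset.prod_const, Finset.card_univ,
    Fintype.card_fin, Finset.sum_sub_distrib, ← Finset.sum_div, ← hq] at hprod
  rw [hsDensity]
  refine (mul_le_mul_of_nonneg_left hprod (Real.exp_pos _).le).trans ?_
  rw [mul_left_comm, ← Real.exp_add]
  gcongr
  have hq2 : s * r / 2 ≤ q := by nlinarith [h.1]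
  have hq4 : r ^ 2 / (1600 * B) ≤ q ^ 2 / (s * s) / (400 * B) := by
    have : (s * r / 2) ^ 2 ≤ q ^ 2 := pow_le_pow_left₀ (by positivity) hq2 2
    rw [div_div, div_le_div_iff₀ (by positivity) (by positivity)]
    nlinarith [mul_le_mul_of_nonneg_right this hB1.le]
  set D : ℝ := 1600 * (1 + M) with hD
  have hD0 : 0 < D := by positivity
  set L : ℝ := 1 + K / 2 with hL
  have hmain : L * r - D * L ^ 2 ≤ r ^ 2 / (1600 * B) := by
    -- If `r ≤ s`, then `B ≤ 1 + M` and completing the square costs at most `D L²`. If `r ≥ s`, then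
    -- `s B ≤ (1 + M) r`, so the gain is at least `r s / D`, and `D L ≤ s` concludes.
    rcases le_total r s with hrs | hrs
    · have : r ^ 2 / D ≤ r ^ 2 / (1600 * B) := by
        have : M * r / s ≤ M := by
          rw [div_le_iff₀ hs0]; gcongr
        gcongr
        rw [hD, hB]; linarith
      refine le_trans ?_ this
      rw [le_div_iff₀ hD0]
      nlinarith [sq_nonneg (r - D * L / 2), sq_nonneg (D * L)]
    · have h1 : L * r ≤ r ^ 2 / (1600 * B) := by
        rw [le_div_iff₀ (by positivity), hB]
        have e : s * (1 + M * r / s) = s + M * r := by field_simp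
        have h2 : s * (1 + M * r / s) ≤ (1 + M) * r := by rw [e]; linarith
        have hL0 : 0 ≤ L := by positivity
        have h3 : (1 + M * r / s) * (L * 1600) ≤ r := by
          have h4 : D * L ≤ s := hs
          have h5 : s * ((1 + M * r / s) * (L * 1600)) ≤ s * r := by
            calc s * ((1 + M * r / s) * (L * 1600)) = s * (1 + M * r / s) * (L * 1600) := by ring
              _ ≤ (1 + M) * r * (L * 1600) := by gcongr
              _ = D * L * r := by rw [hD]; ring
              _ ≤ s * r := by gcongr
          exact le_of_mul_le_mul_left h5 hs0
        nlinarith [mul_le_mul_of_nonneg_left h3 hr0]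
      have : 0 ≤ D * L ^ 2 := by positivity
      linarith
  have hU : upperConst K M = D * L ^ 2 := rfl
  rw [hU]
  have : L * r = r + K / 2 * r := by rw [hL]; ring
  linarith [h.2]

/-! ### Bound uniform in the system size -/

lemma integrable_norm_mul_gauss :
    Integrable (fun w : EuclideanSpace ℝ (Fin M) => Real.exp (-‖w‖ ^ 2) * ‖w‖) := by
  have h := integrable_gauss (M := M) (b := 1 / 2) (by norm_num)
  refine h.mono' (by fun_prop) (ae_of_all _ fun w => ?_)
  rw [Real.norm_of_nonneg (by positivity)]
  have h1 : ‖w‖ ≤ Real.exp (1 / 2 * ‖w‖ ^ 2) := by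
    nlinarith [Real.add_one_le_exp (1 / 2 * ‖w‖ ^ 2), sq_nonneg (‖w‖ - 1)]
  calc Real.exp (-‖w‖ ^ 2) * ‖w‖ ≤ Real.exp (-‖w‖ ^ 2) * Real.exp (1 / 2 * ‖w‖ ^ 2) := by gcongr
    _ = _ := by rw [← Real.exp_add]; congr 1; ring

lemma integrable_quartic {K : ℝ} (hK : 0 < K) :
    Integrable (fun w : EuclideanSpace ℝ (Fin M) =>
      Real.exp (-(K / 2 * ‖w‖ ^ 2) - M ^ 2 * ‖w‖ ^ 4 / 4)) := by
  have h := integrable_gauss (M := M) (b := K / 2) (by positivity)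
  refine h.mono' (by fun_prop) (ae_of_all _ fun w => ?_)
  rw [Real.norm_of_nonneg (by positivity)]
  apply Real.exp_le_exp.2
  have : 0 ≤ (M : ℝ) ^ 2 * ‖w‖ ^ 4 / 4 := by positivity
  linarith

lemma continuous_hsDensity (x : Fin N → Fin M → ℝ) : Continuous (hsDensity x) := by
  unfold hsDensity field
  fun_prop

/-- For patterns with nearly orthogonal columns the marginal is close to uniform. -/
lemma exists_tvDist_le (M : ℕ) {K : ℝ} (hK : 0 < K) :
    ∃ C : ℝ, ∀ (N : ℕ), 1600 * (1 + M) * (1 + K / 2) ≤ Real.sqrt N →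
      ∀ (k : ℕ) (hk : k ≤ N) (x : Fin N → Fin M → ℝ), (∀ i ν, x i ν = -1 ∨ x i ν = 1) →
      crossSq x ≤ K ^ 2 * N →
      tvDist (gibbsMarginal hk 1 x) (rademacherProd k) ≤ C * Real.sqrt (M * (k / Real.sqrt N)) := by
  set c := ∫ w : EuclideanSpace ℝ (Fin M),
    Real.exp (-(K / 2 * ‖w‖ ^ 2) - M ^ 2 * ‖w‖ ^ 4 / 4) with hc
  have hc0 : 0 < c := integral_exp_pos (integrable_quartic hK)
  set I := ∫ w : EuclideanSpace ℝ (Fin M), Real.exp (-‖w‖ ^ 2) * ‖w‖ with hI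
  -- Upper bound on the first moment over lower bound on the mass; the factors `2^N` cancel.
  refine ⟨Real.exp (upperConst K M) * I / c, fun N hN k hk x hx hV => ?_⟩
  have hs0 : 0 < Real.sqrt N := lt_of_lt_of_le (by positivity) hN
  have hN0 : 0 < N := by
    have := Real.sqrt_pos.1 hs0
    exact_mod_cast this
  have hup : ∀ w, hsDensity x w * ‖w‖
      ≤ 2 ^ N * Real.exp (upperConst K M) * (Real.exp (-‖w‖ ^ 2) * ‖w‖) := fun w => by
    have := hsDensity_le x hx hK.le hV hN w
    rw [sub_eq_add_neg, Real.exp_add] at this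
    calc _ ≤ 2 ^ N * (Real.exp (upperConst K M) * Real.exp (-‖w‖ ^ 2)) * ‖w‖ := by gcongr
      _ = _ := by ring
  have hdom := (integrable_norm_mul_gauss (M := M)).const_mul
    (2 ^ N * Real.exp (upperConst K M))
  have hint : Integrable fun w => hsDensity x w * ‖w‖ := by
    refine hdom.mono' ((continuous_hsDensity x).mul continuous_norm).aestronglyMeasurable
      (ae_of_all _ fun w => ?_)
    rw [Real.norm_of_nonneg (mul_nonneg (hsDensity_nonneg x w) (norm_nonneg w))]
    exact hup w
  have h1 : ∫ w, hsDensity x w * ‖w‖ ≤ 2 ^ N * Real.exp (upperConst K M) * I := by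
    rw [hI, ← integral_const_mul]
    exact integral_mono hint hdom hup
  have h2 : 2 ^ N * c ≤ ∫ w, hsDensity x w := by
    rw [hc, ← integral_const_mul]
    exact integral_mono ((integrable_quartic hK).const_mul _) (integrable_hsDensity hN0 x)
      (le_hsDensity hN0 x hx hK.le hV)
  have h3 := tvDist_mul_integral_le hN0 hk x hx hint
  set t := tvDist (gibbsMarginal hk 1 x) (rademacherProd k) with ht
  have ht0 : 0 ≤ t := by
    rw [ht, tvDist]
    exact mul_nonneg (by norm_num) (Finset.sum_nonneg fun _ _ => abs_nonneg _)
  set R := Real.sqrt (M * (k / Real.sqrt N)) with hR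
  have h4 : t * (2 ^ N * c) ≤ R * (2 ^ N * Real.exp (upperConst K M) * I) :=
    (mul_le_mul_of_nonneg_left h2 ht0).trans
      (h3.trans (mul_le_mul_of_nonneg_left h1 (Real.sqrt_nonneg _)))
  have h5 : t * c ≤ R * (Real.exp (upperConst K M) * I) := by
    have h2N : (0 : ℝ) < 2 ^ N := by positivity
    refine le_of_mul_le_mul_left ?_ h2N
    linarith
  rw [div_mul_eq_mul_div, le_div_iff₀ hc0]
  linarith

/-! ### Random patterns are nearly orthogonal -/

section Probability

variable {Ω : Type*} [MeasurableSpace Ω] {P : Measure Ω}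
  {ξ : Fin N → Ω → Fin M → ℝ}

lemma IsPatternFamily.measurable_apply (hξ : IsPatternFamily P ξ) (i : Fin N) (ν : Fin M) :
    Measurable fun ω => ξ i ω ν :=
  (measurable_pi_apply ν).comp (hξ.measurable i)

lemma IsPatternFamily.abs_mul_eq (hξ : IsPatternFamily P ξ) (i : Fin N) (μ ν : Fin M) (ω : Ω) :
    |ξ i ω μ * ξ i ω ν| = 1 := by
  rcases hξ.values i ω μ with h | h <;> rcases hξ.values i ω ν with h' | h' <;> rw [h, h'] <;>
    norm_num

variable [IsProbabilityMeasure P]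

lemma IsPatternFamily.memLp_mul (hξ : IsPatternFamily P ξ) (i : Fin N) (μ ν : Fin M) :
    MemLp (fun ω => ξ i ω μ * ξ i ω ν) 2 P :=
  MemLp.of_bound ((hξ.measurable_apply i μ).mul (hξ.measurable_apply i ν)).aestronglyMeasurable 1
    (ae_of_all _ fun ω => (hξ.abs_mul_eq i μ ν ω).le)

lemma IsPatternFamily.memLp_crossSum (hξ : IsPatternFamily P ξ) (μ ν : Fin M) :
    MemLp (fun ω => crossSum (fun i => ξ i ω) μ ν) 2 P := by
  unfold crossSum
  exact (memLp_finsetSum Finset.univ fun i _ => hξ.memLp_mul i μ ν).sub (memLp_const _)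

/-- Diagonal entries vanish because `ξ² = 1`. Off the diagonal the entry is a sum of `N` independent
products, centred by independence of the coordinates and of variance at most one. -/
lemma IsPatternFamily.integral_crossSum_sq_le (hξ : IsPatternFamily P ξ) (μ ν : Fin M) :
    ∫ ω, crossSum (fun i => ξ i ω) μ ν ^ 2 ∂P ≤ N := by
  by_cases hμν : μ = ν
  · subst hμν
    have : ∀ ω, crossSum (fun i => ξ i ω) μ μ = 0 := fun ω => by
      have h1 : ∀ i, ξ i ω μ * ξ i ω μ = 1 := fun i => by
        rcases hξ.values i ω μ with h | h <;> rw [h] <;> norm_num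
      simp [crossSum, h1]
    simp [this]
  · set Y : Fin N → Ω → ℝ := fun i ω => ξ i ω μ * ξ i ω ν with hY
    have hmean : ∀ i, ∫ ω, Y i ω ∂P = 0 := fun i => by
      have hind := (hξ.coordIndep i).indepFun hμν
      have := hind.integral_mul_eq_mul_integral
        (hξ.measurable_apply i μ).aestronglyMeasurable
        (hξ.measurable_apply i ν).aestronglyMeasurable
      simp only [hξ.centred, mul_zero] at this
      exact this
    have hL : ∀ i, MemLp (Y i) 2 P := fun i => hξ.memLp_mul i μ ν
    have hS : (fun ω => crossSum (fun i => ξ i ω) μ ν) = ∑ i, Y i := by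
      ext ω
      simp [crossSum, hμν, hY]
    have hSL : MemLp (∑ i, Y i) 2 P := memLp_finsetSum' Finset.univ fun i _ => hL i
    have hSmean : ∫ ω, (∑ i, Y i) ω ∂P = 0 := by
      simp only [Finset.sum_apply]
      rw [integral_finsetSum _ fun i _ => (hL i).integrable one_le_two]
      simp [hmean]
    have hvar : Var[∑ i, Y i; P] = ∑ i, Var[Y i; P] := by
      refine IndepFun.variance_sum (fun i _ => hL i) fun i _ j _ hij => ?_
      exact (hξ.indep.indepFun hij).comp
        (φ := fun z : Fin M → ℝ => z μ * z ν) (ψ := fun z : Fin M → ℝ => z μ * z ν)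
        ((measurable_pi_apply μ).mul (measurable_pi_apply ν))
        ((measurable_pi_apply μ).mul (measurable_pi_apply ν))
    have hvar1 : ∀ i, Var[Y i; P] ≤ 1 := fun i => by
      rw [variance_of_integral_eq_zero (hL i).aemeasurable (hmean i)]
      have : ∀ ω, Y i ω ^ 2 = 1 := fun ω => by
        rw [← sq_abs]
        simp only [hY, hξ.abs_mul_eq, one_pow]
      simp [this]
    calc ∫ ω, crossSum (fun i => ξ i ω) μ ν ^ 2 ∂P = ∫ ω, (∑ i, Y i) ω ^ 2 ∂P := by
          rw [← hS]
      _ = Var[∑ i, Y i; P] := (variance_of_integral_eq_zero hSL.aemeasurable hSmean).symm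
      _ ≤ ∑ _i : Fin N, (1 : ℝ) := by
          rw [hvar]; exact Finset.sum_le_sum fun i _ => hvar1 i
      _ = N := by simp

lemma IsPatternFamily.measureReal_crossSq_ge_le (hξ : IsPatternFamily P ξ) (hN : 0 < N) {K : ℝ}
    (hK : 0 < K) : P.real {ω | K ^ 2 * N ≤ crossSq fun i => ξ i ω} ≤ M ^ 2 / K ^ 2 := by
  have hi : ∀ μ ν, Integrable (fun ω => crossSum (fun i => ξ i ω) μ ν ^ 2) P := fun μ ν =>
    (hξ.memLp_crossSum μ ν).integrable_sq
  have hint : Integrable (fun ω => crossSq fun i => ξ i ω) P := by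
    unfold crossSq
    exact integrable_finsetSum _ fun μ _ => integrable_finsetSum _ fun ν _ => hi μ ν
  have hE : ∫ ω, crossSq (fun i => ξ i ω) ∂P ≤ M ^ 2 * N := by
    unfold crossSq
    rw [integral_finsetSum _ fun μ _ => integrable_finsetSum _ fun ν _ => hi μ ν]
    simp only [integral_finsetSum Finset.univ fun ν _ => hi _ ν]
    calc _ ≤ ∑ _μ : Fin M, ∑ _ν : Fin M, (N : ℝ) :=
          Finset.sum_le_sum fun μ _ => Finset.sum_le_sum fun ν _ => hξ.integral_crossSum_sq_le μ ν
      _ = M ^ 2 * N := by simp; ring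
  have hm := mul_meas_ge_le_integral_of_nonneg (μ := P) (f := fun ω => crossSq fun i => ξ i ω)
    (ae_of_all _ fun ω => Finset.sum_nonneg fun μ _ => Finset.sum_nonneg fun ν _ => sq_nonneg _)
    hint (K ^ 2 * N)
  have hN' : (0 : ℝ) < N := by exact_mod_cast hN
  rw [le_div_iff₀ (by positivity)]
  refine le_of_mul_le_mul_left ?_ hN'
  linarith

end Probability

end Hopfield

end

/-! ### Convergence in probability -/

theorem theorem3 {Ω : Type*} [MeasurableSpace Ω] (P : Measure Ω) [IsProbabilityMeasure P]
    (M : ℕ)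
    (ξ : (N : ℕ) → Fin N → Ω → Fin M → ℝ)
    (hξ : ∀ N, Hopfield.IsPatternFamily P (ξ N))
    (k : ℕ → ℕ) (hkN : ∀ N, k N ≤ N)
    (hk : Tendsto k atTop atTop)
    (hk' : Tendsto (fun N : ℕ => (k N : ℝ) / Real.sqrt (N : ℝ)) atTop (𝓝 0)) :
    TendstoInMeasure P
      (fun (N : ℕ) (ω : Ω) =>
        Hopfield.tvDist
          (Hopfield.gibbsMarginal (hkN N) 1 (fun i => ξ N i ω))
          (Hopfield.rademacherProd (k N)))
      atTop (fun _ => (0 : ℝ)) := by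
  rw [tendstoInMeasure_iff_measureReal_norm]
  intro ε hε
  rw [Metric.tendsto_atTop]
  intro δ hδ
  -- `K` is fixed first, so that the bad event has probability below `δ` for every `N > 0`; the
  -- constant `C` then depends only on `M` and `K`.
  obtain ⟨K, hK, hKδ⟩ : ∃ K : ℝ, 0 < K ∧ (M : ℝ) ^ 2 / K ^ 2 < δ := by
    have h : Tendsto (fun K : ℝ => (M : ℝ) ^ 2 / K ^ 2) atTop (𝓝 0) :=
      tendsto_const_nhds.div_atTop (tendsto_pow_atTop two_ne_zero)
    exact ((eventually_gt_atTop 0).and (h.eventually_lt_const hδ)).exists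
  obtain ⟨C, hC⟩ := Hopfield.exists_tvDist_le M hK
  have hlim : Tendsto (fun N : ℕ => C * Real.sqrt (M * ((k N : ℝ) / Real.sqrt N)))
      atTop (𝓝 0) := by
    have h1 := ((Real.continuous_sqrt.tendsto _).comp (hk'.const_mul (M : ℝ))).const_mul C
    simpa using h1
  have hsqrt : Tendsto (fun N : ℕ => Real.sqrt N) atTop atTop :=
    Real.tendsto_sqrt_atTop.comp tendsto_natCast_atTop_atTop
  obtain ⟨N₀, hN₀⟩ := eventually_atTop.1 ((hlim.eventually_lt_const hε).and
    ((hsqrt.eventually_ge_atTop (1600 * (1 + M) * (1 + K / 2))).and (eventually_gt_atTop 0)))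
  refine ⟨N₀, fun N hN => ?_⟩
  obtain ⟨h1, h2, h3⟩ := hN₀ N hN
  rw [Real.dist_eq, sub_zero, abs_of_nonneg measureReal_nonneg]
  refine lt_of_le_of_lt ?_ hKδ
  refine le_trans (measureReal_mono fun ω hω => ?_)
    ((hξ N).measureReal_crossSq_ge_le h3 hK)
  -- Off the bad event the deterministic bound puts the distance below `ε`.
  by_contra hlt
  simp only [Set.mem_ofPred_eq, not_le] at hlt hω
  have ht := hC N h2 (k N) (hkN N) (fun i => ξ N i ω) (fun i ν => (hξ N).values i ω ν) hlt.le
  have ht0 : 0 ≤ Hopfield.tvDist (Hopfield.gibbsMarginal (hkN N) 1 (fun i => ξ N i ω))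
      (Hopfield.rademacherProd (k N)) :=
    mul_nonneg (by norm_num) (Finset.sum_nonneg fun _ _ => abs_nonneg _)
  rw [sub_zero, Real.norm_of_nonneg ht0] at hω
  linarith
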